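/- Let $\mathfrak c=2^{\aleph_0}$, let $\mathfrak d$ be the least cardinality of a set $D\subseteq\omega^\omega$ such that for every $f\in\omega^\omega$ there is $g\in D$ with $f(n)\le g(n)$ for all but finitely many $n$, and let $\mathrm{cov}(\mathcal M)$ be the least cardinality of a cover of $\omega^\omega$ (with the product topology) by nowhere dense sets. Every ordinal $\lambda$ is uniquely of the form $\lambda=\beta+n$ with $\beta$ zero or a limit ordinal and $n<\omega$; put $\lim\lambda=\beta$. For a topological space $X$ let $X^{(\alpha)}=\bigcap_{\xi<\alpha}(X^{(\xi)})^{(1)}$ (so $X^{(0)}=X$), where $Y^{(1)}$ is the set of non-isolated points of the subspace $Y$. The space $X$ is scattered if every nonempty subspace of $X$ has an isolated point. Then for each $x\in X$ there is a unique ordinal $\hbar(x)$ with $x\in X^{(\hbar(x))}\setminus X^{(\hbar(x)+1)}$, and the scattered height of $X$ is the ordinal $\{\hbar(x):x\in X\}$, equivalently the least $\alpha$ with $X^{(\alpha)}=\emptyset$. An FLS space is a Hausdorff first-countable Lindelöf scattered space. A height function on a nonempty topological space $Y$ is a surjection $h$ from $Y$ onto an ordinal $\theta$ such that for every $\alpha<\theta$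 the fibre $h^{-1}\{\alpha\}$ is dense in $\{y\in Y:h(y)\ge\alpha\}$. The scattered $h$-modification of $Y$ is the set $Y$ with the topology generated by the base of all sets $\{x\}\cup\{y\in U:h(y)<h(x)\}$ with $U$ open in $Y$ and $x\in U$. A scattered space is special if it is homeomorphic to the scattered $h$-modification of some nonempty metrizable space $Y$ for some height function $h$ on $Y$. **Theorem.** Assume $\mathrm{cov}(\mathcal M)=\mathfrak d$. Then for every successor ordinal $\lambda<\mathfrak c^+$ with $\mathrm{cf}(\lim\lambda)=\mathrm{cf}(\mathfrak d)$ there exists a separable special FLS space $X$ of cardinality $\mathfrak c$ and scattered height $\lambda$. -/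

import Mathlib

universe u

namespace FLS

open Set Filter Topology Cardinal Ordinal

/-! ### Cardinal characteristics and ordinals -/

/-- `𝔡`: the least cardinality of a family `D ⊆ ω^ω` such that every `f ∈ ω^ω` satisfies
`f ≤* g` for some `g ∈ D`. -/
noncomputable def dominatingNumber : Cardinal.{0} :=
  sInf {κ | ∃ D : Set (ℕ → ℕ), #D = κ ∧ ∀ f : ℕ → ℕ, ∃ g ∈ D, ∀ᶠ n in atTop, f n ≤ g n}

/-- `cov(ℳ)`: the least cardinality of a cover of the Baire space `ω^ω` (with the product
topology) by nowhere dense sets. -/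
noncomputable def covMeager : Cardinal.{0} :=
  sInf {κ | ∃ F : Set (Set (ℕ → ℕ)), #F = κ ∧ (∀ A ∈ F, IsNowhereDense A) ∧ ⋃₀ F = Set.univ}

/-- The limit part `lim α` of an ordinal: the unique ordinal `β`, zero or limit, such that
`α = β + n` for some natural number `n`; see `limitPart_spec` and `limitPart_unique`. -/
noncomputable def limitPart (α : Ordinal.{u}) : Ordinal.{u} := ω * (α / ω)

theorem limitPart_spec (α : Ordinal.{u}) :
    Order.IsSuccPrelimit (limitPart α) ∧ ∃ n : ℕ, α = limitPart α + n := by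
  refine ⟨isSuccPrelimit_iff_omega0_dvd.2 (Dvd.intro _ rfl), ?_⟩
  obtain ⟨n, hn⟩ := lt_omega0.1 (Ordinal.mod_lt α omega0_ne_zero)
  exact ⟨n, by rw [← hn]; exact (Ordinal.div_add_mod α ω).symm⟩

theorem limitPart_unique (β : Ordinal.{u}) (hβ : Order.IsSuccPrelimit β) (n : ℕ) :
    limitPart (β + n) = β := by
  obtain ⟨γ, rfl⟩ := isSuccPrelimit_iff_omega0_dvd.1 hβ
  rw [limitPart, Ordinal.mul_add_div _ omega0_ne_zero,
    Ordinal.div_eq_zero_of_lt (natCast_lt_omega0 n), add_zero]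

/-! ### Scattered spaces -/

section Spaces

variable (X : Type u) [TopologicalSpace X]

/-- Every nonempty subspace has an isolated point. -/
def IsScattered : Prop :=
  ∀ A : Set X, A.Nonempty → ∃ x ∈ A, ∃ U : Set X, IsOpen U ∧ U ∩ A = {x}

/-- The `α`-th Cantor–Bendixson derivative `X^(α)` of the space `X`. -/
def cbDerivative (α : Ordinal.{u}) : Set X :=
  CantorBendixson.iteratedDerivedSet (Set.univ : Set X) α

/-- The recursion `X^(α) = ⋂_{ξ < α} (X^(ξ))^(1)`, where `Y^(1)` is the set of the non-isolated
points of the subspace `Y`. -/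
theorem cbDerivative_eq (α : Ordinal.{u}) :
    cbDerivative X α = {x | ∀ ξ < α, x ∈ cbDerivative X ξ ∧
      ∀ U : Set X, IsOpen U → U ∩ cbDerivative X ξ ≠ {x}} := by
  have key : ∀ (A : Set X) (x : X), x ∈ relDerivedSet A ↔
      (x ∈ A ∧ ∀ U : Set X, IsOpen U → U ∩ A ≠ {x}) := by
    intro A x
    rw [relDerivedSet_apply, mem_inter_iff, and_comm, mem_derivedSet, accPt_iff_nhds]
    refine and_congr_right fun hx => ⟨fun h U hU e => ?_, fun h V hV => ?_⟩
    · have hxU : x ∈ U ∩ A := by rw [e]; rfl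
      obtain ⟨y, hy, hne⟩ := h U (hU.mem_nhds hxU.1)
      rw [e] at hy
      exact hne hy
    · obtain ⟨U, hUV, hU, hxU⟩ := mem_nhds_iff.1 hV
      by_contra! hcon
      refine h U hU (Subset.antisymm (fun y hy => hcon y ⟨hUV hy.1, hy.2⟩) ?_)
      rintro y rfl
      exact ⟨hxU, hx⟩
  ext x
  rw [mem_ofPred_eq]
  constructor
  · intro hx ξ hξ
    rw [← key]
    have h := CantorBendixson.iteratedDerivedSet_antitone (Set.univ : Set X)
      (Order.add_one_le_of_lt hξ) hx
    rwa [CantorBendixson.iteratedDerivedSet_succ] at h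
  · intro h
    unfold cbDerivative
    induction α using Ordinal.limitRecOn with
    | zero => simp
    | add_one a _ =>
      rw [CantorBendixson.iteratedDerivedSet_succ, key]
      exact h a (lt_add_one a)
    | limit a ha _ =>
      rw [CantorBendixson.iteratedDerivedSet_limit ha]
      exact mem_iInter.2 fun b => (h b b.2).1

/-- `X^(∞)`, the intersection of all the Cantor–Bendixson derivatives. -/
def cbKernel : Set X := ⋂ α : Ordinal.{u}, cbDerivative X α

variable {X} in
open Classical in
/-- The Cantor–Bendixson height of a point `x`: the unique `α` with `x ∈ X^(α) \ X^(α+1)` if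
`x ∉ X^(∞)`, and the least `α` with `X^(α) = X^(∞)` if `x ∈ X^(∞)`. -/
noncomputable def cbHeight (x : X) : Ordinal.{u} :=
  if x ∈ cbKernel X then sInf {α | cbDerivative X α = cbKernel X}
  else sInf {α | x ∈ cbDerivative X α \ cbDerivative X (α + 1)}

/-- The ordinal `θ`, identified with the set of the smaller ordinals, is the range of the height
function of `X`. For a scattered space `X` this says that `θ` is its scattered height. -/
def HasHeight (θ : Ordinal.{u}) : Prop :=
  range (cbHeight : X → Ordinal.{u}) = Iio θ

/-- First-countable Lindelöf scattered (Hausdorff) spaces. -/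
structure IsFLS : Prop where
  t2 : T2Space X
  firstCountable : FirstCountableTopology X
  lindelof : LindelofSpace X
  scattered : IsScattered X

end Spaces

/-! ### Scattered modifications -/

section Modifications

variable {Y : Type u} [TopologicalSpace Y]

/-- A height function on `Y`: a surjection onto an ordinal `θ` each fibre `h⁻¹{α}` of which,
`α < θ`, is dense in `h⁻¹[↑α]`. -/
def IsHeightFunction (h : Y → Ordinal.{u}) : Prop :=
  ∃ θ : Ordinal.{u}, range h = Iio θ ∧ ∀ α < θ, h ⁻¹' Ici α ⊆ closure (h ⁻¹' {α})

/-- The underlying set of the scattered `h`-modification of `Y`. -/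
@[nolint unusedArguments]
def Modification (_h : Y → Ordinal.{u}) : Type u := Y

/-- The topology of the scattered `h`-modification, generated by the sets
`B_h(x; U) = {x} ∪ {y ∈ U : h(y) < h(x)}`, where `x ∈ U` and `U` is open in `Y`. -/
instance (h : Y → Ordinal.{u}) : TopologicalSpace (Modification h) :=
  TopologicalSpace.generateFrom
    {B : Set Y | ∃ (x : Y) (U : Set Y), IsOpen U ∧ x ∈ U ∧ B = {x} ∪ {y ∈ U | h y < h x}}

end Modifications

/-- A scattered space is special if it is homeomorphic to a scattered modification of some
(nonempty) metrizable space. -/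
def IsSpecial (X : Type u) [TopologicalSpace X] : Prop :=
  IsScattered X ∧
    ∃ (Y : Type u) (_ : TopologicalSpace Y) (h : Y → Ordinal.{u}),
      Nonempty Y ∧ TopologicalSpace.MetrizableSpace Y ∧ IsHeightFunction h ∧
        Nonempty (X ≃ₜ Modification h)

end FLS

/-!
The space is the scattered modification of the Cantor space `Y = ℕ → Bool` by a height function `h`
onto `lam = β + n + 1`, where `β = limitPart lam`. The modification by any height function on `Y` is
Hausdorff, first countable and scattered, its Cantor–Bendixson height is `h`
(`FLS.cbHeight_modification`), and it is separable when the level `0` is countable. What has to be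
arranged is the Lindelöf property.

The levels `0` and `β, …, β + n` are disjoint countable dense subsets of `Y`. A dominating family
yields closed sets `K ξ`, `ξ < 𝔡`, cofinal among the closed sets missing the level `β`
(`FLS.exists_cofinal_closed_family`), and the equality of cofinalities yields a monotone cofinal map
`φ` from `𝔡` to `β` (`FLS.exists_monotone_cofinal`). A point that lies in none of the `K η`,
`η < ξ`, may receive any height in `[1, φ ξ + ω)`, so that `K ξ` only has heights below the ordinal
`φ ξ + ω` of cofinality `ω`, up to countably many points. Under this restriction the levels below
`β` are made as rich as possible, in the manner of a Bernstein set: whenever `P` is perfect and all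
the `K η`, `η < ξ`, are nowhere dense in `P`, every height in `[1, φ ξ + ω)` is attained in `P`.
There are `𝔠` such requirements, and each can be met by `𝔠` points, because the complement in `P` of
fewer than `𝔡 = cov(ℳ)` nowhere dense sets contains an injective image of the Cantor space
(`FLS.exists_injective_forall_notMem`). This is where the hypothesis `cov(ℳ) = 𝔡` is used.

Let an open cover of the modification be given, and call a set small if countably many members cover
it. By induction on `ξ`, each `K ξ` is small. The members chosen at the points of the level
`φ ξ + k` contain all points of lower height in an open set `G ⊇ h⁻¹{φ ξ + k}` of `Y`, and countably
many of them suffice for this. If `K ξ \ G` were not small, it would contain a nonempty perfect set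
`P` no relatively open part of which is small; then the sets `K η`, `η < ξ`, are nowhere dense in
`P`, and `P` meets the level `φ ξ + k`, which is impossible as this level lies in `G`. So the sets
`K ξ \ G` are small for all `k`, and every remaining point of `K ξ` outside a countable set has
height below some `φ ξ + k` and lies in the set `G` of that `k`; hence `K ξ` is small. In the same
way the part below the level `β` of some open set containing this level is small, and the complement
of that open set lies in some `K ξ`. This is `FLS.lindelofSpace_modification`.
-/

open Set Filter Topology
open scoped Cardinal Ordinal

universe v w

namespace FLS

/-! ### The topology and the height of a scattered modification -/

section Modification

variable {Y : Type u} [TopologicalSpace Y] {h : Y → Ordinal.{u}}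

/-- The sets `B_h(x; U)` are neighbourhood bases: a set is open in the modification when each of its
points `x` has a neighbourhood in `Y` whose points of height below `h x` belong to the set. -/
theorem isOpen_modification_iff {W : Set Y} :
    IsOpen (X := Modification h) W ↔
      ∀ x ∈ W, ∃ V : Set Y, IsOpen V ∧ x ∈ V ∧ {y ∈ V | h y < h x} ⊆ W := by
  constructor
  · intro hW
    induction hW with
    | basic s hs =>
      obtain ⟨z, U, hU, hz, rfl⟩ := hs
      rintro x (rfl | ⟨hx, hlt⟩)
      · exact ⟨U, hU, hz, subset_union_right⟩
      · exact ⟨U, hU, hx, fun y hy => Or.inr ⟨hy.1, hy.2.trans hlt⟩⟩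
    | univ => exact fun x _ => ⟨univ, isOpen_univ, mem_univ _, subset_univ _⟩
    | inter s t _ _ hs ht =>
      intro x hx
      obtain ⟨V, hV, hxV, hVs⟩ := hs x hx.1
      obtain ⟨V', hV', hxV', hVt⟩ := ht x hx.2
      exact ⟨V ∩ V', hV.inter hV', ⟨hxV, hxV'⟩,
        fun y hy => ⟨hVs ⟨hy.1.1, hy.2⟩, hVt ⟨hy.1.2, hy.2⟩⟩⟩
    | sUnion S _ hS =>
      rintro x ⟨s, hs, hx⟩
      obtain ⟨V, hV, hxV, hVs⟩ := hS s hs x hx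
      exact ⟨V, hV, hxV, hVs.trans (subset_sUnion_of_mem hs)⟩
  · intro H
    choose! V hV hxV hVW using H
    have : W = ⋃₀ {B : Set Y | ∃ x ∈ W, B = {x} ∪ {y ∈ V x | h y < h x}} := by
      ext x
      constructor
      · exact fun hx => ⟨_, ⟨x, hx, rfl⟩, Or.inl rfl⟩
      · rintro ⟨_, ⟨z, hz, rfl⟩, (rfl | hx)⟩
        · exact hz
        · exact hVW z hz hx
    rw [this]
    refine TopologicalSpace.GenerateOpen.sUnion _ ?_
    rintro _ ⟨x, hx, rfl⟩
    exact .basic _ ⟨x, V x, hV x hx, hxV x hx, rfl⟩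

theorem isOpen_modification_of_isOpen {U : Set Y} (hU : IsOpen U) :
    IsOpen (X := Modification h) U :=
  isOpen_modification_iff.2 fun _ hx => ⟨U, hU, hx, fun _ hy => hy.1⟩

theorem isScattered_modification (h : Y → Ordinal.{u}) : IsScattered (Modification h) := by
  intro A hA
  obtain ⟨x, hxA, hx⟩ := exists_minimalFor_of_wellFoundedLT (· ∈ A) h hA
  refine ⟨x, hxA, ({x} ∪ {y ∈ (univ : Set Y) | h y < h x} : Set Y), ?_, ?_⟩
  · exact .basic _ ⟨x, univ, isOpen_univ, mem_univ _, rfl⟩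
  · ext y
    constructor
    · rintro ⟨(rfl | hy), hyA⟩
      · rfl
      · exact absurd (hx hyA hy.2.le) hy.2.not_ge
    · rintro rfl
      exact ⟨Or.inl rfl, hxA⟩

theorem t2Space_modification [T2Space Y] (h : Y → Ordinal.{u}) : T2Space (Modification h) := by
  refine ⟨fun x y hxy => ?_⟩
  obtain ⟨U, V, hU, hV, hx, hy, hd⟩ := t2_separation (X := Y) hxy
  exact ⟨U, V, isOpen_modification_of_isOpen hU, isOpen_modification_of_isOpen hV, hx, hy, hd⟩

theorem firstCountable_modification [FirstCountableTopology Y] (h : Y → Ordinal.{u}) :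
    FirstCountableTopology (Modification h) := by
  refine ⟨fun (x : Y) => ?_⟩
  obtain ⟨B, hB⟩ := (𝓝 x).exists_antitone_basis
  have hbasis : (@nhds (Modification h) _ x).HasBasis (fun _ : ℕ => True)
      (fun n => ({x} ∪ {y ∈ B n | h y < h x} : Set Y)) := by
    refine ⟨fun W => ?_⟩
    constructor
    · intro hW
      obtain ⟨W', hW'W, hW', hxW'⟩ := mem_nhds_iff.1 hW
      obtain ⟨V, hV, hxV, hVW⟩ := (isOpen_modification_iff (Y := Y)).1 hW' x hxW'
      obtain ⟨n, -, hn⟩ := hB.1.mem_iff.1 (hV.mem_nhds hxV)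
      refine ⟨n, trivial, ?_⟩
      rintro y (rfl | hy)
      · exact hW'W hxW'
      · exact hW'W (hVW ⟨hn hy.1, hy.2⟩)
    · rintro ⟨n, -, hn⟩
      obtain ⟨U, hUB, hU, hxU⟩ := mem_nhds_iff.1 (hB.1.mem_of_mem (i := n) trivial)
      refine mem_of_superset (IsOpen.mem_nhds (X := Modification h)
        (.basic _ ⟨x, U, hU, hxU, rfl⟩) (Or.inl rfl)) (Subset.trans ?_ hn)
      rintro y (rfl | hy)
      · exact Or.inl rfl
      · exact Or.inr ⟨hUB hy.1, hy.2⟩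
  exact hbasis.isCountablyGenerated

theorem IsHeightFunction.exists_mem_eq (hh : IsHeightFunction h) {x : Y} {ξ : Ordinal.{u}}
    (hξ : ξ ≤ h x) {V : Set Y} (hV : IsOpen V) (hx : x ∈ V) : ∃ y ∈ V, h y = ξ := by
  obtain ⟨θ, hθ, hd⟩ := hh
  have hξθ : ξ < θ := hξ.trans_lt (show h x ∈ Iio θ from hθ ▸ mem_range_self x)
  exact mem_closure_iff.1 (hd ξ hξθ hξ) V hV hx

/-- The height function `h` is recovered from the topology of the modification: its derivatives are
the upper segments `{x | α ≤ h x}`. -/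
theorem mem_cbDerivative_modification (hh : IsHeightFunction h) (α : Ordinal.{u})
    (x : Modification h) : x ∈ cbDerivative (Modification h) α ↔ α ≤ h x := by
  induction α using WellFoundedLT.induction generalizing x with
  | ind α ih =>
    rw [cbDerivative_eq]
    constructor
    · intro hx
      by_contra! hlt
      obtain ⟨-, hx'⟩ := hx _ hlt
      refine hx' ({x} ∪ {y ∈ (univ : Set Y) | h y < h x} : Set Y)
        (.basic _ ⟨x, univ, isOpen_univ, mem_univ _, rfl⟩) ?_
      ext y
      constructor
      · rintro ⟨(rfl | hy), hyA⟩
        · rfl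
        · exact absurd ((ih _ hlt y).1 hyA) hy.2.not_ge
      · rintro rfl
        exact ⟨Or.inl rfl, (ih _ hlt y).2 le_rfl⟩
    · intro hx ξ hξ
      have hlt : ξ < h x := lt_of_lt_of_le hξ hx
      have hxξ := (ih ξ hξ x).2 hlt.le
      refine ⟨hxξ, fun U hU e => ?_⟩
      have hxU : x ∈ U := ((Set.ext_iff.1 e x).2 rfl).1
      obtain ⟨V, hV, hxV, hVU⟩ := (isOpen_modification_iff (Y := Y)).1 hU x hxU
      obtain ⟨y, hyV, hy⟩ := hh.exists_mem_eq (x := x) hlt.le hV hxV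
      obtain rfl : y = x := (Set.ext_iff.1 e y).1 ⟨hVU ⟨hyV, hy ▸ hlt⟩, (ih ξ hξ y).2 hy.ge⟩
      exact hlt.ne' hy

theorem cbHeight_modification (hh : IsHeightFunction h) (x : Modification h) :
    cbHeight x = h x := by
  have hx : x ∉ cbKernel (Modification h) := fun hx =>
    (lt_add_one (h x)).not_ge <|
      (mem_cbDerivative_modification hh _ x).1 (mem_iInter.1 hx (h x + 1))
  have : {α | x ∈ cbDerivative (Modification h) α \ cbDerivative (Modification h) (α + 1)}
      = {(h x : Ordinal.{u})} := by
    ext α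
    rw [mem_ofPred_eq, Set.mem_sdiff, mem_cbDerivative_modification hh,
      mem_cbDerivative_modification hh, Order.add_one_le_iff, not_lt, mem_singleton_iff,
      le_antisymm_iff]
  rw [cbHeight, if_neg hx, this, csInf_singleton]

theorem hasHeight_modification (hh : IsHeightFunction h) {θ : Ordinal.{u}} (hθ : range h = Iio θ) :
    HasHeight (Modification h) θ := by
  have : (cbHeight : Modification h → Ordinal.{u}) = h := funext (cbHeight_modification hh)
  rw [HasHeight, this]
  exact hθ

end Modification

/-! ### A Lindelöf criterion for scattered modifications -/

section Coverable

variable {Y : Type u} {ι : Type w}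

/-- `A` is covered by countably many members of the family `U`. For a family covering `Y` the sets
with this property form a `σ`-ideal containing the countable sets. -/
def CountablyCovered (U : ι → Set Y) (A : Set Y) : Prop :=
  ∃ t : Set ι, t.Countable ∧ A ⊆ ⋃ i ∈ t, U i

variable {U : ι → Set Y} {A B : Set Y}

theorem CountablyCovered.mono (hB : CountablyCovered U B) (hAB : A ⊆ B) : CountablyCovered U A :=
  let ⟨t, ht, hBt⟩ := hB
  ⟨t, ht, hAB.trans hBt⟩

theorem CountablyCovered.iUnion {κ : Type*} [Countable κ] {A : κ → Set Y}
    (hA : ∀ k, CountablyCovered U (A k)) : CountablyCovered U (⋃ k, A k) := by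
  choose t ht hAt using hA
  refine ⟨⋃ k, t k, countable_iUnion ht, iUnion_subset fun k => (hAt k).trans ?_⟩
  exact biUnion_subset_biUnion_left (subset_iUnion t k)

theorem CountablyCovered.union (hA : CountablyCovered U A) (hB : CountablyCovered U B) :
    CountablyCovered U (A ∪ B) := by
  rw [union_eq_iUnion]
  exact .iUnion fun b => by cases b <;> assumption

theorem CountablyCovered.of_countable (hU : ⋃ i, U i = univ) (hA : A.Countable) :
    CountablyCovered U A := by
  have : ∀ x : Y, ∃ i, x ∈ U i := iUnion_eq_univ_iff.1 hU
  choose i hi using this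
  exact ⟨i '' A, hA.image i, fun x hx => mem_biUnion (mem_image_of_mem i hx) (hi x)⟩

variable [TopologicalSpace Y] [SecondCountableTopology Y]

/-- A Cantor–Bendixson argument for the `σ`-ideal of countably covered sets: removing from a closed
set all its countably covered relatively open parts leaves a perfect set. -/
theorem exists_perfect_of_not_countablyCovered (hU : ⋃ i, U i = univ) {F : Set Y}
    (hF : IsClosed F) (hFU : ¬ CountablyCovered U F) :
    ∃ P ⊆ F, Perfect P ∧ P.Nonempty ∧
      ∀ V : Set Y, IsOpen V → (V ∩ P).Nonempty → ¬ CountablyCovered U (V ∩ P) := by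
  set S : Set (Set Y) := {V | IsOpen V ∧ CountablyCovered U (V ∩ F)}
  have hWF : CountablyCovered U (⋃₀ S ∩ F) := by
    obtain ⟨S', hS'c, hS'S, hS'⟩ := TopologicalSpace.isOpen_sUnion_countable S fun V hV => hV.1
    rw [← hS', sUnion_eq_biUnion, iUnion₂_inter]
    have := hS'c.to_subtype
    rw [biUnion_eq_iUnion]
    exact .iUnion fun V => (hS'S V.2).2
  have hWo : IsOpen (⋃₀ S) := isOpen_sUnion fun V hV => hV.1
  have key : ∀ V : Set Y, IsOpen V → (V ∩ (F \ ⋃₀ S)).Nonempty →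
      ¬ CountablyCovered U (V ∩ (F \ ⋃₀ S)) := by
    rintro V hV ⟨x, hxV, hxF, hxS⟩ hc
    refine hxS ⟨V, ⟨hV, (hc.union hWF).mono ?_⟩, hxV⟩
    intro y hy
    by_cases hyS : y ∈ ⋃₀ S
    · exact Or.inr ⟨hyS, hy.2⟩
    · exact Or.inl ⟨hy.1, hy.2, hyS⟩
  refine ⟨F \ ⋃₀ S, sdiff_subset, ⟨hF.sdiff hWo, ?_⟩, ?_, key⟩
  · rw [preperfect_iff_nhds]
    intro x hx V hV
    obtain ⟨V', hV'V, hV', hxV'⟩ := mem_nhds_iff.1 hV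
    by_contra! hcon
    refine key V' hV' ⟨x, hxV', hx⟩ (.of_countable hU ((countable_singleton x).mono ?_))
    exact fun y hy => hcon y ⟨hV'V hy.1, hy.2⟩
  · by_contra! hemp
    refine hFU (hWF.mono fun x hx => ⟨?_, hx⟩)
    by_contra hxS
    exact (hemp ▸ (⟨hx, hxS⟩ : x ∈ F \ ⋃₀ S) : x ∈ (∅ : Set Y))

/-- For an open cover of the modification, the neighbourhoods of the points of the level `γ` cover,
with countably many of them, everything of height below `γ` in an open neighbourhood of this level.
The level itself may be uncountable and need not be covered. -/
theorem exists_isOpen_countablyCovered_below {h : Y → Ordinal.{u}}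
    (hUo : ∀ i, IsOpen (X := Modification h) (U i)) (hU : ⋃ i, U i = univ) (γ : Ordinal.{u}) :
    ∃ G : Set Y, IsOpen G ∧ {x | h x = γ} ⊆ G ∧ CountablyCovered U {x ∈ G | h x < γ} := by
  have : ∀ x : Y, ∃ i, x ∈ U i := iUnion_eq_univ_iff.1 hU
  choose i hi using this
  choose V hV hxV hVU using fun x => isOpen_modification_iff.1 (hUo (i x)) x (hi x)
  obtain ⟨t, htγ, ht, htV⟩ :=
    TopologicalSpace.isOpen_biUnion_countable {x | h x = γ} V fun x _ => hV x
  refine ⟨⋃ x ∈ {x | h x = γ}, V x, isOpen_biUnion fun x _ => hV x,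
    fun x hx => mem_biUnion hx (hxV x), i '' t, ht.image i, ?_⟩
  rw [← htV]
  rintro y ⟨hy, hyγ⟩
  obtain ⟨x, hx, hyx⟩ := mem_iUnion₂.1 hy
  have hxγ : h x = γ := htγ hx
  exact mem_biUnion (mem_image_of_mem i hx) (hVU x ⟨hyx, hxγ ▸ hyγ⟩)

end Coverable

variable {Y : Type u} [TopologicalSpace Y] [SecondCountableTopology Y]

/-- Let the closed sets `K ξ` be cofinal among the closed sets disjoint from the level `β`, let the
heights on `K ξ` be bounded by the limit ordinal `φ ξ + ω` up to a countable set, and let every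
perfect subset of `K ξ` in which all the earlier `K η` are nowhere dense meet all the levels
`φ ξ + n`. Then each `K ξ` is countably covered by any open cover, by induction on `ξ`: the part of
`K ξ` missed by a neighbourhood of the level `φ ξ + n` has no perfect kernel relative to the
`σ`-ideal of countably covered sets, and the neighbourhoods of these levels together contain all
but countably many of the remaining points at a height above their own. -/
theorem lindelofSpace_modification {T : Type v} [LinearOrder T] [WellFoundedLT T]
    {h : Y → Ordinal.{u}} {K : T → Set Y} {φ : T → Ordinal.{u}} {β : Ordinal.{u}} {C : Set Y}
    (hC : C.Countable) (hCβ : ∀ x ∉ C, h x < β)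
    (hK : ∀ ξ, IsClosed (K ξ))
    (hcof : ∀ F : Set Y, IsClosed F → (∀ x ∈ F, h x ≠ β) → ∃ ξ, F ⊆ K ξ)
    (hbound : ∀ ξ, ∀ x ∈ K ξ, x ∉ C → h x < φ ξ + ω)
    (hmeet : ∀ (ξ : T) (n : ℕ) (P : Set Y), Perfect P → P.Nonempty → P ⊆ K ξ →
      (∀ η < ξ, ∀ V : Set Y, IsOpen V → (V ∩ P).Nonempty → ¬ V ∩ P ⊆ K η) →
        ∃ x ∈ P, h x = φ ξ + n) :
    LindelofSpace (Modification h) := by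
  refine ⟨isLindelof_of_countable_subcover fun {ι} (U : ι → Set Y) hUo hU => ?_⟩
  replace hU : ⋃ i, U i = univ := univ_subset_iff.1 hU
  change CountablyCovered U univ
  have hcovK : ∀ ξ, CountablyCovered U (K ξ) := by
    intro ξ
    induction ξ using WellFoundedLT.induction with
    | ind ξ ih =>
      choose G hG hGγ hGc using fun n : ℕ =>
        exists_isOpen_countablyCovered_below hUo hU (φ ξ + n)
      have hdiff : ∀ n, CountablyCovered U (K ξ \ G n) := by
        intro n
        by_contra hn
        obtain ⟨P, hP, hPp, hPn, hPV⟩ :=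
          exists_perfect_of_not_countablyCovered hU ((hK ξ).sdiff (hG n)) hn
        obtain ⟨x, hxP, hx⟩ := hmeet ξ n P hPp hPn (hP.trans sdiff_subset)
          fun η hη V hV hne hsub => hPV V hV hne ((ih η hη).mono hsub)
        exact (hP hxP).2 (hGγ n hx)
      refine (((CountablyCovered.iUnion hdiff).union (CountablyCovered.iUnion hGc)).union
        (.of_countable hU hC)).mono fun x hx => ?_
      by_cases hxC : x ∈ C
      · exact Or.inr hxC
      · obtain ⟨n, hn⟩ : ∃ n : ℕ, h x < φ ξ + n := by
          obtain ⟨c, hc, hle⟩ := (Ordinal.lt_add_iff Ordinal.omega0_ne_zero).1 (hbound ξ x hx hxC)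
          obtain ⟨n, rfl⟩ := Ordinal.lt_omega0.1 hc
          refine ⟨n + 1, hle.trans_lt ?_⟩
          rw [Nat.cast_add_one, ← add_assoc]
          exact lt_add_one _
        refine Or.inl ?_
        by_cases hxG : x ∈ G n
        · exact Or.inr (mem_iUnion.2 ⟨n, hxG, hn⟩)
        · exact Or.inl (mem_iUnion.2 ⟨n, hx, hxG⟩)
  obtain ⟨G, hG, hGβ, hGc⟩ := exists_isOpen_countablyCovered_below hUo hU β
  obtain ⟨ξ, hξ⟩ := hcof Gᶜ hG.isClosed_compl fun x hx hxβ => hx (hGβ hxβ)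
  refine (((hcovK ξ).union hGc).union (.of_countable hU hC)).mono fun x _ => ?_
  by_cases hxC : x ∈ C
  · exact Or.inr hxC
  · refine Or.inl ?_
    by_cases hxG : x ∈ G
    · exact Or.inr ⟨hxG, hCβ x hxC⟩
    · exact Or.inl (hξ hxG)

/-! ### Distinct representatives and generic sequences -/

/-- A family of at most `κ` sets of cardinality at least `κ` has distinct representatives. -/
theorem exists_injective_mem_of_mk_le {I Y : Type u} (S : I → Set Y) (hS : ∀ i, #I ≤ #(S i)) :
    ∃ f : I → Y, Function.Injective f ∧ ∀ i, f i ∈ S i := by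
  obtain ⟨r, hr, hord⟩ := Cardinal.exists_ord_eq I
  have hex : ∀ (i : I) (g : {j // r j i} → Y), (S i \ range g).Nonempty := by
    intro i g
    by_contra! hemp
    have hsub : S i ⊆ range g := by
      rw [sdiff_eq_empty] at hemp
      exact hemp
    have h1 : #(S i) ≤ #{j // r j i} :=
      (Cardinal.mk_le_mk_of_subset hsub).trans Cardinal.mk_range_le
    have h2 : #{j // r j i} < #I := by
      have := Cardinal.card_typein_lt i hord
      simpa using this
    exact (h1.trans_lt h2).not_ge (hS i)
  choose pick hpick using hex
  let f : I → Y := hr.wf.fix fun i g => pick i fun j => g j.1 j.2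
  have hf : ∀ i, f i ∈ S i \ range fun j : {j // r j i} => f j.1 := by
    intro i
    have : f i = pick i fun j => f j.1 := hr.wf.fix_eq _ i
    rw [this]
    exact hpick i _
  refine ⟨f, fun i j hij => ?_, fun i => (hf i).1⟩
  by_contra hne
  rcases trichotomous_of r i j with h | h | h
  · exact (hf j).2 ⟨⟨i, h⟩, hij⟩
  · exact hne h
  · exact (hf i).2 ⟨⟨j, h⟩, hij.symm⟩

/-- `MA(countable)` below `cov(ℳ)`: fewer than `cov(ℳ)`, or countably many, dense subsets of a
countable preorder are all met by some decreasing sequence. A point of `ω^ω` codes a decreasing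
sequence, each coordinate choosing the next extension, and the codes of the sequences that miss a
given dense set form a nowhere dense set. The countable case is Baire's theorem; it is included
because that `cov(ℳ)` is uncountable is not needed otherwise. -/
theorem exists_antitone_forall_exists_mem {P : Type*} [Preorder P] [Countable P] [Nonempty P]
    {I : Type} (hI : #I < covMeager ∨ Countable I) (D : I → Set P) (hD : ∀ i p, ∃ q ≤ p, q ∈ D i) :
    ∃ p : ℕ → P, Antitone p ∧ ∀ i, ∃ n, p n ∈ D i := by
  obtain ⟨p₀⟩ := ‹Nonempty P›
  have hext : ∀ p : P, ∃ e : ℕ → P, Iic p = range e := fun p =>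
    (Iic p).to_countable.exists_eq_range ⟨p, le_rfl⟩
  choose e he using hext
  -- `e p` enumerates the extensions of `p`, and `s c` is the decreasing sequence coded by `c`.
  let s : (ℕ → ℕ) → ℕ → P := fun c n => n.rec p₀ fun k p => e p (c k)
  have hs_succ : ∀ c n, s c (n + 1) = e (s c n) (c n) := fun c n => rfl
  have hs_anti : ∀ c, Antitone (s c) := fun c => antitone_nat_of_succ_le fun n => by
    have : e (s c n) (c n) ∈ Iic (s c n) := by rw [he]; exact mem_range_self _
    exact this
  have hs_congr : ∀ c c' n, (∀ k < n, c k = c' k) → s c n = s c' n := by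
    intro c c' n
    induction n with
    | zero => exact fun _ => rfl
    | succ n ih =>
      intro hcc
      rw [hs_succ, hs_succ, ih fun k hk => hcc k (hk.trans n.lt_succ_self), hcc n n.lt_succ_self]
  have hs_open : ∀ n (A : Set P), IsOpen {c | s c n ∈ A} := by
    intro n A
    rw [isOpen_iff_mem_nhds]
    intro c hc
    refine mem_of_superset ((PiNat.isOpen_cylinder (fun _ => ℕ) c n).mem_nhds
      (PiNat.self_mem_cylinder c n)) fun c' hc' => ?_
    change s c' n ∈ A
    rw [hs_congr c' c n fun k hk => hc' k hk]
    exact hc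
  let A : I → Set (ℕ → ℕ) := fun i => {c | ∀ n, s c n ∉ D i}
  have hclosed : ∀ i, IsClosed (A i) := by
    intro i
    have : A i = ⋂ n, {c | s c n ∈ D i}ᶜ := by ext c; simp [A]
    rw [this]
    exact isClosed_iInter fun n => (hs_open n _).isClosed_compl
  have hA : ∀ i, interior (A i) = ∅ := by
    intro i
    rw [eq_empty_iff_forall_notMem]
    intro c hc
    obtain ⟨U, ⟨-, ⟨x, n, rfl⟩, hcU⟩, hUA⟩ :
        ∃ U, (IsOpen U ∧ (∃ x n, U = PiNat.cylinder x n) ∧ c ∈ U) ∧ U ⊆ A i := by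
      obtain ⟨U, hU, hcU, hUA⟩ := (PiNat.isTopologicalBasis_cylinders
        (fun _ : ℕ => ℕ)).exists_subset_of_mem_open hc isOpen_interior
      obtain ⟨x, n, rfl⟩ := hU
      exact ⟨_, ⟨PiNat.isOpen_cylinder _ x n, ⟨x, n, rfl⟩, hcU⟩, hUA.trans interior_subset⟩
    obtain ⟨q, hq, hqD⟩ := hD i (s c n)
    have hq : q ∈ range (e (s c n)) := he _ ▸ hq
    obtain ⟨k, rfl⟩ := hq
    have hc' : Function.update c n k ∈ A i := by
      refine hUA fun j hj => ?_
      rw [Function.update_of_ne hj.ne]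
      exact hcU j hj
    refine hc' (n + 1) ?_
    rw [hs_succ, Function.update_self,
      hs_congr (Function.update c n k) c n fun j hj => Function.update_of_ne hj.ne _ _]
    exact hqD
  have hne : ⋃₀ range A ≠ univ := by
    intro hU
    rcases hI with hI | hI
    · have h1 : covMeager ≤ #(range A) := csInf_le' ⟨range A, rfl, forall_mem_range.2 fun i => by
        rw [IsNowhereDense, (hclosed i).closure_eq, hA i], hU⟩
      exact (h1.trans Cardinal.mk_range_le).not_gt hI
    · rw [sUnion_range] at hU
      obtain ⟨i, hi⟩ := nonempty_interior_of_iUnion_of_closed hclosed hU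
      exact hi.ne_empty (hA i)
  obtain ⟨c, hc⟩ := (ne_univ_iff_exists_notMem _).1 hne
  refine ⟨s c, hs_anti c, fun i => ?_⟩
  by_contra! hcon
  exact hc ⟨A i, mem_range_self i, hcon⟩

/-! ### Large sets of generic points in perfect sets -/

theorem infinite_inter_of_preperfect {Y : Type*} [TopologicalSpace Y] [T1Space Y] {C V : Set Y}
    (hC : Preperfect C) (hV : IsOpen V) (hne : (V ∩ C).Nonempty) : (V ∩ C).Infinite := by
  intro hfin
  obtain ⟨x, hxV, hxC⟩ := hne
  have hfin' : ((V ∩ C) \ {x}).Finite := hfin.subset sdiff_subset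
  obtain ⟨y, ⟨⟨hyV, hy⟩, hyC⟩, hyx⟩ := preperfect_iff_nhds.1 hC x hxC (V \ ((V ∩ C) \ {x}))
    ((hV.sdiff hfin'.isClosed).mem_nhds ⟨hxV, fun h => h.2 rfl⟩)
  exact hy ⟨⟨hyV, hyC⟩, hyx⟩

/-- The finite approximations to an injection of the Cantor space into the set `C`: an approximation
of length `n` assigns to every binary sequence of length `n` a clopen set meeting `C`. -/
structure CantorApprox {Y : Type*} [TopologicalSpace Y] (C : Set Y) where
  /-- The length of the binary sequences on which the approximation is defined. -/
  length : ℕ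
  /-- The clopen set assigned to a binary sequence. -/
  val : (Fin length → Bool) → TopologicalSpace.Clopens Y
  nonempty : ∀ t, ((val t : Set Y) ∩ C).Nonempty

namespace CantorApprox

variable {Y : Type} [TopologicalSpace Y] {C : Set Y}

/-- The clopen set assigned to the initial segment of an infinite binary sequence. -/
def eval (p : CantorApprox C) (x : ℕ → Bool) : Set Y := p.val fun i => x i

/-- Stronger approximations are longer and assign smaller sets. -/
instance : Preorder (CantorApprox C) where
  le q p := p.length ≤ q.length ∧ ∀ x, q.eval x ⊆ p.eval x
  le_refl p := ⟨le_rfl, fun _ => Subset.rfl⟩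
  le_trans _ _ _ h h' := ⟨h'.1.trans h.1, fun x => (h.2 x).trans (h'.2 x)⟩

instance [Countable (TopologicalSpace.Clopens Y)] : Countable (CantorApprox C) := by
  let f : CantorApprox C → Σ n : ℕ, ((Fin n → Bool) → TopologicalSpace.Clopens Y) :=
    fun p => ⟨p.length, p.val⟩
  refine Function.Injective.countable (f := f) ?_
  rintro ⟨n, v, hv⟩ ⟨m, w, hw⟩ h
  obtain ⟨rfl, h⟩ := Sigma.mk.inj h
  obtain rfl := eq_of_heq h
  rfl

/-- An approximation can be extended to any length `n` and shrunk around prescribed points `y t`. -/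
theorem exists_le_of_forall_mem_isOpen [T2Space Y] [CompactSpace Y] [TotallyDisconnectedSpace Y]
    (p : CantorApprox C) {n : ℕ} (hn : p.length ≤ n) (y : (Fin n → Bool) → Y)
    (U : (Fin n → Bool) → Set Y) (hU : ∀ t, IsOpen (U t)) (hyU : ∀ t, y t ∈ U t)
    (hy : ∀ t, y t ∈ (p.val (t ∘ Fin.castLE hn) : Set Y) ∩ C) :
    ∃ q ≤ p, ∀ x, q.eval x ⊆ U fun i => x i := by
  have hV : ∀ t, ∃ V : Set Y, IsClopen V ∧ y t ∈ V ∧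
      V ⊆ U t ∩ (p.val (t ∘ Fin.castLE hn) : Set Y) := fun t =>
    compact_exists_isClopen_in_isOpen ((hU t).inter (p.val _).isOpen) ⟨hyU t, (hy t).1⟩
  choose V hV hyV hVU using hV
  refine ⟨⟨n, fun t => ⟨V t, hV t⟩, fun t => ⟨y t, hyV t, (hy t).2⟩⟩,
    ⟨hn, fun x => (hVU _).trans inter_subset_right⟩, fun x => (hVU _).trans inter_subset_left⟩

variable [T2Space Y] [CompactSpace Y] [TotallyDisconnectedSpace Y]

theorem exists_le_disjoint (p : CantorApprox C) {A : Set Y} (hA : IsClosed A)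
    (hCA : ∀ V : Set Y, IsOpen V → (V ∩ C).Nonempty → ¬ V ∩ C ⊆ A) :
    ∃ q ≤ p, ∀ x, Disjoint (q.eval x) A := by
  choose y hy hyA using fun t => not_subset.1 (hCA _ (p.val t).isOpen (p.nonempty t))
  obtain ⟨q, hqp, hq⟩ := p.exists_le_of_forall_mem_isOpen le_rfl y (fun _ => Aᶜ)
    (fun _ => hA.isOpen_compl) hyA hy
  exact ⟨q, hqp, fun x => subset_compl_iff_disjoint_right.1 (hq x)⟩

theorem exists_le_separated (p : CantorApprox C) (hC : Preperfect C) (m : ℕ) :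
    ∃ q ≤ p, ∀ x x' : ℕ → Bool, (∃ i < m, x i ≠ x' i) → Disjoint (q.eval x) (q.eval x') := by
  have hn : p.length ≤ max p.length m := le_max_left _ _
  obtain ⟨y, hy_inj, hy⟩ := exists_injective_mem_of_mk_le
    (fun t : Fin (max p.length m) → Bool => (p.val (t ∘ Fin.castLE hn) : Set Y) ∩ C) fun t =>
      (Cardinal.mk_le_aleph0).trans (Cardinal.infinite_iff.1
        (infinite_inter_of_preperfect hC (p.val _).isOpen (p.nonempty _)).to_subtype)
  obtain ⟨U, hU, hUd⟩ := (finite_range y).t2_separation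
  obtain ⟨q, hqp, hq⟩ := p.exists_le_of_forall_mem_isOpen hn y (fun t => U (y t))
    (fun t => (hU _).2) (fun t => (hU _).1) hy
  refine ⟨q, hqp, fun x x' ⟨i, hi, hne⟩ => ?_⟩
  refine (hUd (mem_range_self _) (mem_range_self _) (hy_inj.ne fun h => hne ?_)).mono
    (hq x) (hq x')
  exact congrFun h ⟨i, hi.trans_le (le_max_right _ _)⟩

end CantorApprox

/-- The complement of fewer than `cov(ℳ)` nowhere dense sets in a perfect set contains an injective
image of the Cantor space, obtained from a sequence of finite approximations that is generic
enough to separate points and to avoid each of these sets. -/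
theorem exists_injective_forall_notMem {Y : Type} [TopologicalSpace Y] [T2Space Y] [CompactSpace Y]
    [TotallyDisconnectedSpace Y] [SecondCountableTopology Y] {C : Set Y} (hC : Perfect C)
    (hne : C.Nonempty) {I : Type} (hI : #I < covMeager) (A : I → Set Y) (hA : ∀ i, IsClosed (A i))
    (hCA : ∀ i, ∀ V : Set Y, IsOpen V → (V ∩ C).Nonempty → ¬ V ∩ C ⊆ A i) :
    ∃ e : (ℕ → Bool) → Y, Function.Injective e ∧ ∀ x, e x ∈ C ∧ ∀ i, e x ∉ A i := by
  have : Countable (TopologicalSpace.Clopens Y) :=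
    TopologicalSpace.Clopens.countable_iff_secondCountable.2 inferInstance
  have : Nonempty (CantorApprox C) := ⟨⟨0, fun _ => ⊤, fun _ => by simpa using hne⟩⟩
  let D : I ⊕ ℕ → Set (CantorApprox C) := Sum.elim
    (fun i => {q | ∀ x, Disjoint (q.eval x) (A i)})
    fun m => {q | ∀ x x' : ℕ → Bool, (∃ i < m, x i ≠ x' i) → Disjoint (q.eval x) (q.eval x')}
  have hIN : #(I ⊕ ℕ) < covMeager ∨ Countable (I ⊕ ℕ) := by
    rcases le_or_gt #I ℵ₀ with h | h
    · have : Countable I := Cardinal.mk_le_aleph0_iff.1 h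
      exact Or.inr inferInstance
    · refine Or.inl ?_
      rwa [Cardinal.mk_sum, Cardinal.lift_id, Cardinal.lift_id, Cardinal.mk_nat,
        Cardinal.add_eq_left h.le h.le]
  obtain ⟨p, hp, hpD⟩ := exists_antitone_forall_exists_mem hIN D fun i p => by
    rcases i with i | m
    · exact p.exists_le_disjoint (hA i) (hCA i)
    · exact p.exists_le_separated hC.acc m
  have hmem : ∀ x, (⋂ n, (p n).eval x ∩ C).Nonempty := by
    intro x
    have hcl : ∀ n, IsClosed ((p n).eval x ∩ C) := fun n => ((p n).val _).isClosed.inter hC.closed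
    exact IsCompact.nonempty_iInter_of_sequence_nonempty_isCompact_isClosed _
      (fun n => inter_subset_inter_left _ ((hp n.le_succ).2 x)) (fun n => (p n).nonempty _)
      (hcl 0).isCompact hcl
  choose e he using hmem
  have he : ∀ x n, e x ∈ (p n).eval x ∩ C := fun x n => mem_iInter.1 (he x) n
  refine ⟨e, fun x x' hxx' => ?_, fun x => ⟨(he x 0).2, fun i hi => ?_⟩⟩
  · by_contra hne
    obtain ⟨i, hi⟩ := Function.ne_iff.1 hne
    obtain ⟨n, hn⟩ := hpD (Sum.inr (i + 1))
    exact disjoint_left.1 (hn x x' ⟨i, i.lt_succ_self, hi⟩) (he x n).1 (hxx' ▸ (he x' n).1)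
  · obtain ⟨n, hn⟩ := hpD (Sum.inl i)
    exact disjoint_left.1 (hn x) (he x n).1 hi

/-! ### Dominating families and closed sets missing a countable set -/

theorem exists_dominating_family :
    ∃ D : Set (ℕ → ℕ), #D = dominatingNumber ∧ ∀ f : ℕ → ℕ, ∃ g ∈ D, ∀ᶠ n in atTop, f n ≤ g n :=
  csInf_mem (s := {κ | ∃ D : Set (ℕ → ℕ), #D = κ ∧
    ∀ f : ℕ → ℕ, ∃ g ∈ D, ∀ᶠ n in atTop, f n ≤ g n})
    ⟨_, univ, rfl, fun f => ⟨f, mem_univ f, .of_forall fun _ => le_rfl⟩⟩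

theorem dominatingNumber_le_continuum : dominatingNumber ≤ 𝔠 := by
  have h : dominatingNumber ≤ #(univ : Set (ℕ → ℕ)) :=
    csInf_le' ⟨univ, rfl, fun f => ⟨f, mem_univ f, .of_forall fun _ => le_rfl⟩⟩
  simpa using h

theorem aleph0_le_dominatingNumber : ℵ₀ ≤ dominatingNumber := by
  obtain ⟨D, hD, hdom⟩ := exists_dominating_family
  rw [← hD, ← Cardinal.infinite_iff, infinite_coe_iff]
  intro hfin
  obtain ⟨g, hg, hle⟩ := hdom fun n => ∑ g ∈ hfin.toFinset, g n + 1
  obtain ⟨n, hn⟩ := hle.exists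
  have := Finset.single_le_sum (f := fun g : ℕ → ℕ => g n) (fun _ _ => Nat.zero_le _)
    (hfin.mem_toFinset.2 hg)
  exact absurd hn (by simpa using Nat.lt_succ_of_le this)

/-- Among the closed sets missing a given countable set there is a cofinal family of size `𝔡`: a
function `g` is sent to the complement of the union of the `g i`-th basic neighbourhoods of the
points `q i`. -/
theorem exists_cofinal_closed_family {Y : Type*} [TopologicalSpace Y] [FirstCountableTopology Y]
    (q : ℕ → Y) {T : Type} (hT : #T = dominatingNumber) :
    ∃ K : T → Set Y, (∀ ξ, IsClosed (K ξ)) ∧ (∀ ξ i, q i ∉ K ξ) ∧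
      ∀ F : Set Y, IsClosed F → (∀ i, q i ∉ F) → ∃ ξ, F ⊆ K ξ := by
  obtain ⟨D, hD, hdom⟩ := exists_dominating_family
  choose B hB using fun i => (𝓝 (q i)).exists_antitone_basis
  -- Finite modifications turn domination almost everywhere into domination everywhere.
  have hcard : #T = #(D × ℕ) := by
    rw [Cardinal.mk_prod, Cardinal.lift_id, Cardinal.lift_id, hD, Cardinal.mk_nat, hT,
      Cardinal.mul_eq_left aleph0_le_dominatingNumber aleph0_le_dominatingNumber
        Cardinal.aleph0_ne_zero]
  obtain ⟨e⟩ := Cardinal.eq.1 hcard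
  refine ⟨fun ξ => (⋃ i, interior (B i (max ((e ξ).1.1 i) (e ξ).2)))ᶜ,
    fun ξ => (isOpen_iUnion fun i => isOpen_interior).isClosed_compl, fun ξ i hi => hi ?_, ?_⟩
  · exact mem_iUnion.2 ⟨i, mem_interior_iff_mem_nhds.2 ((hB i).1.mem_of_mem trivial)⟩
  · intro F hF hqF
    have : ∀ i, ∃ n, B i n ⊆ Fᶜ := fun i => by
      obtain ⟨n, -, hn⟩ := (hB i).1.mem_iff.1 (hF.isOpen_compl.mem_nhds (hqF i))
      exact ⟨n, hn⟩
    choose f hf using this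
    obtain ⟨g, hgD, hg⟩ := hdom f
    obtain ⟨N, hN⟩ := eventually_atTop.1 hg
    refine ⟨e.symm (⟨g, hgD⟩, ∑ i ∈ Finset.range N, f i), fun x hx hxU => ?_⟩
    obtain ⟨i, hi⟩ := mem_iUnion.1 hxU
    refine hf i ((hB i).2 ?_ (interior_subset hi)) hx
    rw [Equiv.apply_symm_apply, le_max_iff]
    rcases le_or_gt N i with h | h
    · exact Or.inl (hN i h)
    · exact Or.inr (Finset.single_le_sum (f := f) (fun _ _ => Nat.zero_le _)
        (Finset.mem_range.2 h))

/-! ### Monotone cofinal maps between ordinals of equal cofinality -/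

/-- Along fundamental sequences `g` of `α` and `f` of `β` of the same length, the map sends `ξ` to
`f i` for the least `i` with `ξ ≤ g i`. -/
theorem exists_monotone_cofinal {α β : Ordinal.{u}} (hcof : β.cof = α.cof) :
    ∃ φ : α.ToType → Ordinal.{u}, Monotone φ ∧ (∀ ξ, φ ξ < β) ∧ ∀ γ < β, ∃ ξ, γ ≤ φ ξ := by
  obtain ⟨f, hf⟩ := Ordinal.exists_isFundamentalSeq (o := β) rfl
  obtain ⟨g, hg⟩ := Ordinal.exists_isFundamentalSeq (o := α) (congrArg Cardinal.ord hcof.symm)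
  have hleast : ∀ ξ : Iio α, ∃ i, IsLeast {i | ξ ≤ g i} i := fun ξ => by
    obtain ⟨_, ⟨i, rfl⟩, hi⟩ := hg.isCofinal_range ξ
    obtain ⟨j, hj⟩ := exists_minimal_of_wellFoundedLT (fun i => ξ ≤ g i) ⟨i, hi⟩
    exact ⟨j, hj.1, fun k hk => (le_total j k).elim id fun h => hj.2 hk h⟩
  choose m hm using hleast
  refine ⟨fun ξ => f (m ξ.toOrd), fun ξ ξ' h => ?_, fun ξ => (f _).2, fun γ hγ => ?_⟩
  · have : m ξ.toOrd ≤ m ξ'.toOrd :=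
      (hm _).2 (((Ordinal.ToType.mk.symm.monotone h).trans (hm ξ'.toOrd).1 : _))
    exact hf.strictMono.monotone this
  · obtain ⟨_, ⟨i, rfl⟩, hi⟩ := hf.isCofinal_range ⟨γ, hγ⟩
    refine ⟨Ordinal.ToType.mk (g i), ?_⟩
    have h1 : i ≤ m (g i) := hg.strictMono.le_iff_le.1 (hm (g i)).1
    have h2 : (⟨γ, hγ⟩ : Iio β) ≤ f (m (g i)) := hi.trans (hf.strictMono.monotone h1)
    simpa using show γ ≤ (f (m (g i)) : Ordinal.{u}) from h2

/-! ### Perfect sets and the number of closed sets -/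

theorem preperfect_of_isOpen_cantor {V : Set (ℕ → Bool)} (hV : IsOpen V) : Preperfect V := by
  rw [preperfect_iff_nhds]
  intro x hx U hU
  obtain ⟨W, ⟨z, n, rfl⟩, hxW, hW⟩ := (PiNat.isTopologicalBasis_cylinders
    (fun _ : ℕ => Bool)).mem_nhds_iff.1 (inter_mem hU (hV.mem_nhds hx))
  refine ⟨Function.update x n (!x n), hW fun i hi => ?_, fun h => ?_⟩
  · rw [Function.update_of_ne hi.ne]
    exact hxW i hi
  · simpa using congrFun h n

/-- A closed set is determined by the basic open sets disjoint from it. -/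
theorem mk_closeds_le_continuum (Y : Type u) [TopologicalSpace Y] [SecondCountableTopology Y] :
    #(TopologicalSpace.Closeds Y) ≤ 𝔠 := by
  let B := TopologicalSpace.countableBasis Y
  have hB := TopologicalSpace.isBasis_countableBasis Y
  have := (TopologicalSpace.countable_countableBasis Y).to_subtype
  let f : TopologicalSpace.Closeds Y → Set B := fun F => {V | Disjoint (V : Set Y) F}
  have hf : ∀ F G, f F = f G → (G : Set Y) ⊆ F := fun F G h x hx => by
    by_contra hxF
    obtain ⟨V, hV, hxV, hVF⟩ := hB.exists_subset_of_mem_open (show x ∈ (F : Set Y)ᶜ from hxF)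
      F.isClosed.isOpen_compl
    have : (⟨V, hV⟩ : B) ∈ f G := h ▸ (subset_compl_iff_disjoint_right.1 hVF : _)
    exact disjoint_left.1 this hxV hx
  refine (Cardinal.mk_le_of_injective (f := f) fun F G h =>
    SetLike.coe_injective ((hf _ _ h.symm).antisymm (hf _ _ h))).trans ?_
  rw [Cardinal.mk_set, ← Cardinal.two_power_aleph0]
  exact Cardinal.power_le_power_left two_ne_zero Cardinal.mk_le_aleph0

/-! ### The height function -/

/-- Disjoint countable dense sets indexed by a countable type `A`: the set of index `a` is the image
of `N × {a}` under an injection. -/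
theorem exists_injective_dense (A : Type) [Countable A] :
    ∃ (N : Type) (d : N × A → ℕ → Bool), Countable N ∧ Function.Injective d ∧
      ∀ a, Dense (range fun v => d (v, a)) := by
  have : Countable (TopologicalSpace.Clopens (ℕ → Bool)) :=
    TopologicalSpace.Clopens.countable_iff_secondCountable.2 inferInstance
  let N := {V : TopologicalSpace.Clopens (ℕ → Bool) // (V : Set (ℕ → Bool)).Nonempty}
  obtain ⟨d, hd, hdV⟩ := exists_injective_mem_of_mk_le
    (fun i : N × A => (i.1.1 : Set (ℕ → Bool))) fun i => by
      refine Cardinal.mk_le_aleph0.trans (Cardinal.infinite_iff.1 (Set.infinite_coe_iff.2 ?_))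
      have := infinite_inter_of_preperfect (preperfect_of_isOpen_cantor i.1.1.isOpen) isOpen_univ
        (by simpa using i.1.2)
      simpa using this
  refine ⟨N, d, inferInstance, hd, fun a => dense_iff_inter_open.2 fun U hU ⟨x, hx⟩ => ?_⟩
  obtain ⟨V, hV, hxV, hVU⟩ := compact_exists_isClopen_in_isOpen hU hx
  exact ⟨_, hVU (hdV (⟨⟨V, hV⟩, x, hxV⟩, a)), mem_range_self _⟩

/-- The choice of the points at the uncountable levels. Whenever `P` is a nonempty perfect set in
which the sets `K η`, `η < ξ`, are nowhere dense, and `b : B` is a label, the set `P` contains a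
point outside of these `K η` and of the countable set `C`, and such points can be taken distinct. -/
theorem exists_injective_perfect {T B : Type} [LinearOrder T]
    (hTcov : ∀ ξ : T, #(Iio ξ) < covMeager) (hT : #T ≤ 𝔠) (hB : #B ≤ 𝔠)
    {K : T → Set (ℕ → Bool)} (hK : ∀ ξ, IsClosed (K ξ)) {C : Set (ℕ → Bool)} (hC : C.Countable) :
    ∃ (I : Type) (c : I → ℕ → Bool) (ξ : I → T) (b : I → B), Function.Injective c ∧
      (∀ i, c i ∉ C) ∧ (∀ i, ∀ η < ξ i, c i ∉ K η) ∧
      ∀ (P : Set (ℕ → Bool)) (ξ₀ : T) (b₀ : B), Perfect P → P.Nonempty →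
        (∀ η < ξ₀, ∀ V : Set (ℕ → Bool), IsOpen V → (V ∩ P).Nonempty → ¬ V ∩ P ⊆ K η) →
          ∃ i, c i ∈ P ∧ ξ i = ξ₀ ∧ b i = b₀ := by
  let I := {i : TopologicalSpace.Closeds (ℕ → Bool) × T × B //
    Perfect (i.1 : Set (ℕ → Bool)) ∧ (i.1 : Set (ℕ → Bool)).Nonempty ∧
      ∀ η < i.2.1, ∀ V : Set (ℕ → Bool), IsOpen V → (V ∩ i.1).Nonempty → ¬ V ∩ i.1 ⊆ K η}
  have hI : #I ≤ 𝔠 := by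
    refine (Cardinal.mk_subtype_le _).trans ?_
    rw [Cardinal.mk_prod, Cardinal.mk_prod]
    simp only [Cardinal.lift_id]
    exact (mul_le_mul' (mk_closeds_le_continuum _) (mul_le_mul' hT hB)).trans (by simp)
  let S : I → Set (ℕ → Bool) := fun i =>
    {x | x ∈ (i.1.1 : Set (ℕ → Bool)) ∧ x ∉ C ∧ ∀ η < i.1.2.1, x ∉ K η}
  have hS : ∀ i, #I ≤ #(S i) := by
    rintro ⟨⟨P, ξ, b⟩, hP, hne, hPK⟩
    refine hI.trans ?_
    obtain ⟨e, he, heP⟩ := exists_injective_forall_notMem hP hne (hTcov ξ)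
      (fun η => K η.1) (fun η => hK _) fun η => hPK η.1 η.2
    have hcount : #(e ⁻¹' C) < #(ℕ → Bool) := by
      refine (Cardinal.le_aleph0_iff_set_countable.2 (hC.preimage he)).trans_lt ?_
      simpa using Cardinal.aleph0_lt_continuum
    have hcompl := Cardinal.mk_compl_of_infinite _ hcount
    calc 𝔠 = #((e ⁻¹' C)ᶜ : Set (ℕ → Bool)) := by rw [hcompl]; simp
      _ = #(e '' (e ⁻¹' C)ᶜ) := (Cardinal.mk_image_eq he).symm
      _ ≤ _ := Cardinal.mk_le_mk_of_subset ?_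
    rintro _ ⟨x, hx, rfl⟩
    exact ⟨(heP x).1, hx, fun η hη => (heP x).2 ⟨η, hη⟩⟩
  obtain ⟨c, hc, hcS⟩ := exists_injective_mem_of_mk_le S hS
  refine ⟨I, c, fun i => i.1.2.1, fun i => i.1.2.2, hc, fun i => (hcS i).2.1,
    fun i => (hcS i).2.2, fun P ξ b hP hne hPK => ?_⟩
  let i : I := ⟨⟨⟨P, hP.closed⟩, ξ, b⟩, hP, hne, hPK⟩
  exact ⟨i, (hcS i).1, rfl, rfl⟩

/-- The height function of the construction, on the Cantor space. The levels `0` and `β + k`,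
`k ≤ n`, are countable. The closed sets `K ξ` are cofinal among those missing the level `β`, and
points outside of all `K η`, `η < ξ`, may get any height between `1` and `φ ξ + ω`; this freedom is
used to meet every perfect set in which these `K η` are nowhere dense. -/
theorem exists_height (hcov : covMeager = dominatingNumber) {β : Ordinal.{0}}
    (hβ : Order.IsSuccLimit β) (hβc : β.card ≤ 𝔠) (hcf : β.cof = dominatingNumber.ord.cof) (n : ℕ) :
    ∃ h : (ℕ → Bool) → Ordinal.{0}, range h = Iio (β + n + 1) ∧
      (∀ γ < β + n + 1, Dense (h ⁻¹' {γ})) ∧ (h ⁻¹' {0}).Countable ∧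
        LindelofSpace (Modification h) := by
  let T := dominatingNumber.ord.ToType
  obtain ⟨φ₀, hφ₀, hφ₀β, hφ₀cof⟩ :
      ∃ φ : T → Ordinal.{0}, Monotone φ ∧ (∀ ξ, φ ξ < β) ∧ ∀ γ < β, ∃ ξ, γ ≤ φ ξ :=
    exists_monotone_cofinal hcf
  have hTcard : #T = dominatingNumber := by simp [T]
  have hTcov : ∀ ξ : T, #(Iio ξ) < covMeager := fun ξ => by
    rw [hcov]
    exact (Cardinal.mk_Iio_lt ξ (by simp [T])).trans_eq hTcard
  have hβ1 : 1 < β := Ordinal.one_lt_of_isSuccLimit hβ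
  let φ : T → Ordinal.{0} := fun ξ => max 1 (φ₀ ξ)
  have hφ : Monotone φ := fun ξ η hξη => max_le_max_left 1 (hφ₀ hξη)
  have hφβ : ∀ ξ, φ ξ < β := fun ξ => max_lt hβ1 (hφ₀β ξ)
  have hφω : ∀ ξ, φ ξ < φ ξ + ω := fun ξ => lt_add_of_pos_right _ Ordinal.omega0_pos
  have hωβ : ∀ ξ, φ ξ + ω ≤ β := fun ξ => by
    refine (Ordinal.add_le_iff Ordinal.omega0_ne_zero).2 fun k hk => ?_
    obtain ⟨k, rfl⟩ := Ordinal.lt_omega0.1 hk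
    exact hβ.add_natCast_lt (hφβ ξ) k
  -- The countable levels: `none` stands for the level `0` and `some k` for the level `β + k`.
  obtain ⟨N, d, hN, hd, hdense⟩ := exists_injective_dense (Option (Fin (n + 1)))
  let lev : Option (Fin (n + 1)) → Ordinal.{0} := fun a => a.elim 0 fun k => β + (k : ℕ)
  have hdC : (range d).Countable := countable_range d
  obtain ⟨q, hq⟩ := (countable_range fun v => d (v, some 0)).exists_eq_range
    (hdense (some 0)).nonempty
  obtain ⟨K, hK, hqK, hKcof⟩ := exists_cofinal_closed_family q hTcard
  obtain ⟨I, c, ξ, b, hc, hcd, hcK, hcP⟩ := exists_injective_perfect (B := β.ToType) hTcov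
    (hTcard.trans_le dominatingNumber_le_continuum) (by simpa using hβc) hK hdC
  let γ : I → Ordinal.{0} := fun i => (b i).toOrd
  -- The label `b i` is the height of `c i` if it is one of the heights allowed at stage `ξ i`.
  let lab : I → Ordinal.{0} := fun i => open Classical in
    if 1 ≤ γ i ∧ γ i < φ (ξ i) + ω then γ i else 1
  have hlab : ∀ i, 1 ≤ lab i ∧ lab i < φ (ξ i) + ω := fun i => by
    by_cases hi : 1 ≤ γ i ∧ γ i < φ (ξ i) + ω
    · simp only [lab, if_pos hi]
      exact hi
    · simp only [lab, if_neg hi]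
      exact ⟨le_rfl, (le_max_left _ _).trans_lt (hφω _)⟩
  let h : (ℕ → Bool) → Ordinal.{0} :=
    Function.extend d (fun i => lev i.2) (Function.extend c lab fun _ => 1)
  have hhd : ∀ v a, h (d (v, a)) = lev a := fun v a => hd.extend_apply _ _ (v, a)
  have hhc : ∀ i, h (c i) = lab i := fun i => by
    have h1 : h (c i) = _ := Function.extend_apply' _ _ _ (hcd i)
    rw [h1, hc.extend_apply]
  have hh : ∀ x ∉ range d, 1 ≤ h x ∧ h x < β ∧ ∀ η, x ∈ K η → h x < φ η + ω := fun x hx => by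
    by_cases hxc : x ∈ range c
    · obtain ⟨i, rfl⟩ := hxc
      rw [hhc]
      refine ⟨(hlab i).1, (hlab i).2.trans_le (hωβ _), fun η hη => (hlab i).2.trans_le ?_⟩
      have : ξ i ≤ η := not_lt.1 fun hlt => hcK i η hlt hη
      exact add_le_add_left (hφ this) _
    · have h1 : h x = 1 := by
        have h1 : h x = _ := Function.extend_apply' _ _ _ hx
        rw [h1, Function.extend_apply' _ _ _ hxc]
      rw [h1]
      exact ⟨le_rfl, hβ1, fun η _ => (le_max_left _ _).trans_lt (hφω η)⟩
  have hmeet : ∀ (P : Set (ℕ → Bool)) (ξ₀ : T) (γ₀ : Ordinal.{0}), Perfect P → P.Nonempty →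
      (∀ η < ξ₀, ∀ V : Set (ℕ → Bool), IsOpen V → (V ∩ P).Nonempty → ¬ V ∩ P ⊆ K η) →
      1 ≤ γ₀ → γ₀ < φ ξ₀ + ω → ∃ x ∈ P, h x = γ₀ := by
    intro P ξ₀ γ₀ hP hne hPK h1 hlt
    obtain ⟨i, hiP, hiξ, hib⟩ :=
      hcP P ξ₀ (Ordinal.ToType.mk ⟨γ₀, hlt.trans_le (hωβ ξ₀)⟩) hP hne hPK
    have hγ : γ i = γ₀ := by simp [γ, hib]
    refine ⟨c i, hiP, ?_⟩
    rw [hhc]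
    simp only [lab, hγ, hiξ, if_pos (And.intro h1 hlt)]
  have hlevel : ∀ γ₀ < β + n + 1, Dense (h ⁻¹' {γ₀}) := by
    intro γ₀ hγ₀
    rcases eq_or_ne γ₀ 0 with rfl | h0
    · refine (hdense none).mono (range_subset_iff.2 fun v => ?_)
      exact hhd v none
    rcases lt_or_ge γ₀ β with hγβ | hγβ
    · obtain ⟨ξ₀, hξ₀⟩ := hφ₀cof γ₀ hγβ
      refine dense_iff_inter_open.2 fun U hU ⟨x, hx⟩ => ?_
      obtain ⟨V, hV, hxV, hVU⟩ := compact_exists_isClopen_in_isOpen hU hx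
      obtain ⟨y, hyV, hy⟩ := hmeet V ξ₀ γ₀
        ⟨hV.isClosed, preperfect_of_isOpen_cantor hV.isOpen⟩ ⟨x, hxV⟩ (fun η _ W hW hne hsub => by
          obtain ⟨z, hz, hzq⟩ := (hdense (some 0)).inter_open_nonempty _ (hW.inter hV.isOpen) hne
          obtain ⟨i, rfl⟩ : z ∈ range q := hq ▸ hzq
          exact hqK η i (hsub hz))
        (Order.one_le_iff_ne_zero.2 h0) ((hξ₀.trans (le_max_right _ _)).trans_lt (hφω ξ₀))
      exact ⟨y, hVU hyV, hy⟩
    · obtain ⟨δ, rfl⟩ := exists_add_of_le hγβ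
      rw [add_assoc, add_lt_add_iff_left, ← Nat.cast_add_one] at hγ₀
      obtain ⟨k, rfl⟩ := Ordinal.lt_omega0.1 (hγ₀.trans (Ordinal.natCast_lt_omega0 _))
      refine (hdense (some ⟨k, Nat.cast_lt.1 hγ₀⟩)).mono (range_subset_iff.2 fun v => ?_)
      exact hhd v _
  have hlevd : ∀ a, lev a < β + n + 1 := by
    rintro (_ | k)
    · exact add_pos_of_right one_pos _
    · refine Order.lt_add_one_iff.2 (add_le_add_right ?_ β)
      exact Nat.cast_le.2 (Nat.lt_succ_iff.1 k.2)
  refine ⟨h, ?_, hlevel, hdC.mono ?_, ?_⟩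
  · refine Subset.antisymm (range_subset_iff.2 fun x => ?_) fun γ₀ hγ₀ => ?_
    · by_cases hx : x ∈ range d
      · obtain ⟨⟨v, a⟩, rfl⟩ := hx
        rw [hhd]
        exact hlevd a
      · refine (hh x hx).2.1.trans_le ?_
        rw [add_assoc]
        exact le_self_add
    · exact (hlevel γ₀ hγ₀).nonempty
  · intro x hx
    by_contra hxd
    exact (Order.one_le_iff_ne_zero.1 (hh x hxd).1) hx
  · refine lindelofSpace_modification (φ := φ) (K := K) (β := β) hdC (fun x hx => (hh x hx).2.1) hK
      (fun F hF hFβ => hKcof F hF fun i hi => hFβ _ hi ?_)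
      (fun η x hx hxd => (hh x hxd).2.2 η hx)
      fun ξ₀ k P hP hne _ hPK => hmeet P ξ₀ _ hP hne hPK
        ((le_max_left _ _).trans le_self_add)
        (add_lt_add_right (Ordinal.natCast_lt_omega0 k) _)
    obtain ⟨v, hv⟩ : q i ∈ range fun v => d (v, some 0) := hq ▸ mem_range_self i
    rw [← hv, hhd]
    simp [lev]

theorem separableSpace_modification {Y : Type u} [TopologicalSpace Y] {h : Y → Ordinal.{u}}
    (hc : (h ⁻¹' {0}).Countable) (hd : Dense (h ⁻¹' {0})) :
    TopologicalSpace.SeparableSpace (Modification h) := by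
  refine ⟨⟨(h ⁻¹' {0} : Set Y), hc, dense_iff_inter_open.2 fun W hW ⟨x, hx⟩ => ?_⟩⟩
  rcases eq_or_ne (h x) 0 with h0 | h0
  · exact ⟨x, hx, h0⟩
  · obtain ⟨V, hV, hxV, hVW⟩ := (isOpen_modification_iff (Y := Y)).1 hW x hx
    obtain ⟨y, hyV, hy⟩ := hd.inter_open_nonempty V hV ⟨x, hxV⟩
    have hy : h y = 0 := hy
    exact ⟨y, hVW ⟨hyV, hy ▸ pos_iff_ne_zero.2 h0⟩, hy⟩

end FLS

theorem theorem4p2 (hcov : FLS.covMeager = FLS.dominatingNumber)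
    (lam : Ordinal.{0}) (hsucc : ∃ β : Ordinal.{0}, lam = β + 1)
    (hlt : lam < (Order.succ Cardinal.continuum.{0}).ord)
    (hcf : (FLS.limitPart lam).cof = FLS.dominatingNumber.ord.cof) :
    ∃ (X : Type) (_ : TopologicalSpace X),
      TopologicalSpace.SeparableSpace X ∧ FLS.IsSpecial X ∧ FLS.IsFLS X ∧
        Cardinal.mk X = Cardinal.continuum ∧ FLS.HasHeight X lam := by
  obtain ⟨hpre, m, hm⟩ := FLS.limitPart_spec lam
  have hlamc : lam.card ≤ 𝔠 := Order.lt_succ_iff.1 (Cardinal.lt_ord.1 hlt)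
  set β := FLS.limitPart lam
  have hβ0 : β ≠ 0 := by
    rw [Ne, ← Ordinal.cof_eq_zero, hcf, Ordinal.cof_eq_zero, Cardinal.ord_eq_zero]
    exact (Cardinal.aleph0_pos.trans_le FLS.aleph0_le_dominatingNumber).ne'
  have hβ : Order.IsSuccLimit β := Ordinal.isSuccLimit_iff.2 ⟨hβ0, hpre⟩
  obtain ⟨n, rfl⟩ : ∃ n, m = n + 1 := by
    refine Nat.exists_eq_succ_of_ne_zero fun h0 => ?_
    obtain ⟨δ, hδ⟩ := hsucc
    rw [h0, Nat.cast_zero, add_zero, hδ] at hm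
    exact (hβ.add_one_lt (hm ▸ lt_add_one δ)).ne hm
  have hlam : lam = β + n + 1 := by rw [hm, Nat.cast_add_one, add_assoc]
  have hβc : β.card ≤ 𝔠 := by
    refine (Ordinal.card_le_card ?_).trans hlamc
    conv_rhs => rw [hm]
    exact le_self_add
  obtain ⟨h, hrange, hdense, hcount, hlind⟩ := FLS.exists_height hcov hβ hβc hcf n
  have h0 : (0 : Ordinal.{0}) < β + n + 1 := add_pos_of_right one_pos _
  have hh : FLS.IsHeightFunction h := ⟨_, hrange, fun γ hγ => by
    rw [(hdense γ hγ).closure_eq]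
    exact subset_univ _⟩
  have hsc := FLS.isScattered_modification h
  refine ⟨FLS.Modification h, inferInstance, FLS.separableSpace_modification hcount (hdense 0 h0),
    ⟨hsc, ℕ → Bool, inferInstance, h, inferInstance, inferInstance, hh, ⟨Homeomorph.refl _⟩⟩,
    ⟨FLS.t2Space_modification h, FLS.firstCountable_modification h, hlind, hsc⟩, ?_, ?_⟩
  · change #(ℕ → Bool) = 𝔠
    simp
  · rw [hlam]
    exact FLS.hasHeight_modification hh hrange
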